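/- Let $\mathcal M'_1=(\mathcal N',\mathcal I'_1)$ and $\mathcal M'_2=(\mathcal N',\mathcal I'_2)$ be two matroids on the same finite ground set $\mathcal N'$, let $W$ be a natural number, and let $w:\mathcal N'\to\{1,2,\dots,W\}$ be an integer weight function. Let $$\mathrm{opt}'=\max\Big\{\sum_{e\in I'}w(e)\;:\;I'\in\mathcal I'_1\cap\mathcal I'_2\Big\}$$ be the maximum weight of a common independent set. Define the unfolded instance as follows. The ground set is $\mathcal N=\{e_i : e\in\mathcal N',\ 1\le i\le w(e)\}$, i.e. each $e\in\mathcal N'$ is replaced by $w(e)$ distinct copies $e_1,\dots,e_{w(e)}$. For $I\subseteq\mathcal N$ and $1\le i\le W$ put $$I'_{1,i}=\{e\in\mathcal N' : i\le w(e),\ e_i\in I\},\qquad I'_{2,i}=\{e\in\mathcal N' : i\le w(e),\ e_{w(e)-i+1}\in I\}.$$ Let $\mathcal I_1$ be the family of all $I\subseteq\mathcal N$ such that $I'_{1,i}\in\mathcal I'_1$ for all $1\le i\le W$, and let $\mathcal I_2$ be the family of all $I\subseteq\mathcal N$ such that $I'_{2,i}\in\mathcal I'_2$ for all $1\le i\le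 W$. Then $\mathcal M_1=(\mathcal N,\mathcal I_1)$ and $\mathcal M_2=(\mathcal N,\mathcal I_2)$ are matroids, and the maximum cardinality of a common independent set of them equals the maximum weight of a common independent set of the original pair: $$\max\{|I| : I\in\mathcal I_1\cap\mathcal I_2\}=\mathrm{opt}'.$$ -/

import Mathlib

/-- The unfolded ground set: every `e ∈ E` is replaced by its `w e` copies `e_1, …, e_{w e}`;
the copy `e_i` is the pair `(e, i)`. -/
def unfoldedGround {α : Type*} (E : Set α) (w : α → ℕ) : Set (α × ℕ) :=
  {p | p.1 ∈ E ∧ 1 ≤ p.2 ∧ p.2 ≤ w p.1}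

/-- The `i`-th layer `{e | e_i ∈ I}` used for the first matroid. -/
def firstLayer {α : Type*} (I : Set (α × ℕ)) (i : ℕ) : Set α :=
  {e | (e, i) ∈ I}

/-- The `i`-th layer `{e | e_{w(e) - i + 1} ∈ I}` used for the second matroid. The index
`j = w(e) - i + 1` is described by `j + i = w(e) + 1`, to avoid truncated subtraction. -/
def secondLayer {α : Type*} (w : α → ℕ) (I : Set (α × ℕ)) (i : ℕ) : Set α :=
  {e | ∃ j : ℕ, j + i = w e + 1 ∧ (e, j) ∈ I}

/-- Independence in the first unfolded matroid of a weighted matroid with weights in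
`{1, …, W}`. -/
def UnfoldedIndepFirst {α : Type*} (M : Matroid α) (w : α → ℕ) (W : ℕ)
    (I : Set (α × ℕ)) : Prop :=
  I ⊆ unfoldedGround M.E w ∧ ∀ i : ℕ, 1 ≤ i → i ≤ W → M.Indep (firstLayer I i)

/-- Independence in the second unfolded matroid of a weighted matroid with weights in
`{1, …, W}`. -/
def UnfoldedIndepSecond {α : Type*} (M : Matroid α) (w : α → ℕ) (W : ℕ)
    (I : Set (α × ℕ)) : Prop :=
  I ⊆ unfoldedGround M.E w ∧ ∀ i : ℕ, 1 ≤ i → i ≤ W → M.Indep (secondLayer w I i)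

/-- `k` is the maximum weight of a common (finite) independent set of `M₁` and `M₂`. -/
def IsMaxCommonIndepWeight {α : Type*} (M₁ M₂ : Matroid α) (w : α → ℕ) (k : ℕ) : Prop :=
  IsGreatest {n : ℕ | ∃ I : Finset α, M₁.Indep ↑I ∧ M₂.Indep ↑I ∧ ∑ e ∈ I, w e = n} k

/-- `k` is the maximum cardinality of a common (finite) independent set of `M₁` and `M₂`. -/
def IsMaxCommonIndepCard {β : Type*} (M₁ M₂ : Matroid β) (k : ℕ) : Prop :=
  IsGreatest {n : ℕ | ∃ I : Finset β, M₁.Indep ↑I ∧ M₂.Indep ↑I ∧ I.card = n} k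

/-! Duality for weighted matroid intersection closes a cycle of inequalities. Split `w = u + v` and
charge each part the sum of the ranks of its upper level sets. An unfolded common independent set is
at most as large as the cost of any splitting (`card_le_of_layerMatroid_indep`); the cheapest
splitting costs at most the weight of some common independent set
(`exists_common_indep_splittingValue_le`); and all copies of the elements of such a set form an
unfolded one of that cardinality.

The second inequality is an induction that deletes or contracts an element `e`. The least cost is
convex in the weight of `e` (`splittingValue_convex`). If it is no larger at `w e` than at 0,
deletion suffices. Otherwise it grows by at least 1 per unit from `w e` on, which allows comparison
with a weight so large that `e` lies in every nonempty level set; there the cost is controlled by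
the contraction. -/

/-- The rank function of a matroid, as a function on finite sets. -/
structure IsMatroidRank {α : Type*} [DecidableEq α] (r : Finset α → ℕ) : Prop where
  empty : r ∅ = 0
  singleton_le : ∀ e, r {e} ≤ 1
  mono : ∀ X Y, X ⊆ Y → r X ≤ r Y
  submod : ∀ X Y, r (X ∪ Y) + r (X ∩ Y) ≤ r X + r Y

theorem IsMatroidRank.insert_loop {α : Type*} [DecidableEq α] {r : Finset α → ℕ}
    (hr : IsMatroidRank r) {e : α} (he : r {e} = 0) (X : Finset α) : r (insert e X) = r X := by
  have h := hr.submod {e} X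
  have h2 := hr.mono X (insert e X) (Finset.subset_insert e X)
  rw [← Finset.insert_eq] at h
  omega

theorem IsMatroidRank.contract {α : Type*} [DecidableEq α] {r : Finset α → ℕ}
    (hr : IsMatroidRank r) {e : α} (he : r {e} = 1) :
    IsMatroidRank (fun X => r (insert e X) - 1) where
  empty := by simp [he]
  singleton_le x := by
    have h := hr.submod {e} {x}
    have := hr.singleton_le x
    rw [← Finset.insert_eq] at h
    omega
  mono X Y h := Nat.sub_le_sub_right (hr.mono _ _ (Finset.insert_subset_insert e h)) 1
  submod X Y := by
    have h := hr.submod (insert e X) (insert e Y)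
    rw [← Finset.insert_union_distrib, ← Finset.insert_inter_distrib] at h
    have h1 : ∀ X, 1 ≤ r (insert e X) := fun X => by
      rw [← he]; exact hr.mono _ _ (by simp)
    have := h1 (X ∪ Y)
    have := h1 (X ∩ Y)
    have := h1 X
    have := h1 Y
    omega

/-! ### Level rank sums -/

/-- The maximum `u`-weight of a set independent with respect to `r` in `S`, written as the sum
of the ranks of the upper level sets of `u`. -/
def levelRankSum {α : Type*} (S : Finset α) (r : Finset α → ℕ) (u : α → ℕ) : ℕ :=
  ∑ j ∈ Finset.range (S.sup u), r {x ∈ S | j < u x}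

theorem levelRankSum_eq {α : Type*} (S : Finset α) {r : Finset α → ℕ} (h0 : r ∅ = 0)
    (u : α → ℕ) {N : ℕ} (hN : ∀ x ∈ S, u x ≤ N) :
    levelRankSum S r u = ∑ j ∈ Finset.range N, r {x ∈ S | j < u x} := by
  refine Finset.sum_subset (by simpa using hN) fun j _ hj => ?_
  rw [Finset.filter_false_of_mem, h0]
  intro x hx
  have : u x ≤ S.sup u := Finset.le_sup hx
  simp only [Finset.mem_range] at hj
  omega

/-- Translation submodularity of the level rank sum. -/
theorem levelRankSum_translation_submodular {α : Type*} [DecidableEq α] (S : Finset α)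
    {r : Finset α → ℕ} (hr : IsMatroidRank r) (a b : α → ℕ) (k : ℕ) :
    levelRankSum S r (fun x => max (a x - k) (b x)) + levelRankSum S r (fun x => min (a x) (b x + k))
      ≤ levelRankSum S r a + levelRankSum S r b := by
  set N := S.sup a + S.sup b
  have ha : ∀ x ∈ S, a x ≤ S.sup a := fun x hx => Finset.le_sup hx
  have hb : ∀ x ∈ S, b x ≤ S.sup b := fun x hx => Finset.le_sup hx
  rw [levelRankSum_eq S hr.empty (fun x => max (a x - k) (b x)) (N := N)
      (fun x hx => by have := ha x hx; have := hb x hx; omega),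
    levelRankSum_eq S hr.empty (fun x => min (a x) (b x + k)) (N := k + N)
      (fun x hx => by have := ha x hx; have := hb x hx; omega),
    levelRankSum_eq S hr.empty a (N := k + N)
      (fun x hx => by have := ha x hx; omega),
    levelRankSum_eq S hr.empty b (N := N)
      (fun x hx => by have := hb x hx; omega),
    Finset.sum_range_add _ k N, Finset.sum_range_add _ k N]
  -- The lowest `k` levels need only monotonicity. Above them, level `k + j` of `a` is paired with
  -- level `j` of `b`; their union and intersection are the levels of the max and the min.
  have h1 : ∑ j ∈ Finset.range k, r {x ∈ S | j < min (a x) (b x + k)}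
      ≤ ∑ j ∈ Finset.range k, r {x ∈ S | j < a x} := by
    refine Finset.sum_le_sum fun j _ => hr.mono _ _ fun x hx => ?_
    simp only [Finset.mem_filter] at hx ⊢
    exact ⟨hx.1, by omega⟩
  have h2 : ∑ j ∈ Finset.range N, r {x ∈ S | j < max (a x - k) (b x)}
      + ∑ j ∈ Finset.range N, r {x ∈ S | k + j < min (a x) (b x + k)}
      ≤ ∑ j ∈ Finset.range N, r {x ∈ S | k + j < a x}
      + ∑ j ∈ Finset.range N, r {x ∈ S | j < b x} := by
    rw [← Finset.sum_add_distrib, ← Finset.sum_add_distrib]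
    refine Finset.sum_le_sum fun j _ => ?_
    have hunion : {x ∈ S | j < max (a x - k) (b x)} =
        {x ∈ S | k + j < a x} ∪ {x ∈ S | j < b x} := by
      rw [← Finset.filter_or]
      exact Finset.filter_congr fun x _ => by omega
    have hinter : {x ∈ S | k + j < min (a x) (b x + k)} =
        {x ∈ S | k + j < a x} ∩ {x ∈ S | j < b x} := by
      rw [← Finset.filter_and]
      exact Finset.filter_congr fun x _ => by omega
    rw [hunion, hinter]
    exact hr.submod _ _
  omega

/-! ### Weight splittings and convexity -/

/-- The value of the best splitting of `w` into two weight functions. -/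
noncomputable def splittingValue {α : Type*} (S : Finset α) (r₁ r₂ : Finset α → ℕ) (w : α → ℕ) : ℕ :=
  sInf {k | ∃ u v : α → ℕ, (∀ x, u x + v x = w x) ∧ levelRankSum S r₁ u + levelRankSum S r₂ v = k}

theorem exists_splitting {α : Type*} (S : Finset α) (r₁ r₂ : Finset α → ℕ) (w : α → ℕ) :
    ∃ u v : α → ℕ, (∀ x, u x + v x = w x) ∧
      levelRankSum S r₁ u + levelRankSum S r₂ v = splittingValue S r₁ r₂ w :=
  Nat.sInf_mem (s := {k | ∃ u v : α → ℕ, (∀ x, u x + v x = w x) ∧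
    levelRankSum S r₁ u + levelRankSum S r₂ v = k}) ⟨_, w, 0, by simp, rfl⟩

theorem splittingValue_le {α : Type*} (S : Finset α) (r₁ r₂ : Finset α → ℕ) {w u v : α → ℕ}
    (h : ∀ x, u x + v x = w x) :
    splittingValue S r₁ r₂ w ≤ levelRankSum S r₁ u + levelRankSum S r₂ v :=
  Nat.sInf_le ⟨u, v, h, rfl⟩

theorem splittingValue_comm {α : Type*} (S : Finset α) (r₁ r₂ : Finset α → ℕ) (w : α → ℕ) :
    splittingValue S r₁ r₂ w = splittingValue S r₂ r₁ w := by
  refine le_antisymm ?_ ?_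
  · obtain ⟨u, v, h, h'⟩ := exists_splitting S r₂ r₁ w
    rw [← h', add_comm]
    exact splittingValue_le S r₁ r₂ fun x => by rw [add_comm, h]
  · obtain ⟨u, v, h, h'⟩ := exists_splitting S r₁ r₂ w
    rw [← h', add_comm]
    exact splittingValue_le S r₂ r₁ fun x => by rw [add_comm, h]

theorem two_mul_splittingValue_le_of_splittings {α : Type*} [DecidableEq α] (S : Finset α)
    {r₁ r₂ : Finset α → ℕ} (h₁ : IsMatroidRank r₁) (h₂ : IsMatroidRank r₂) (w : α → ℕ) (e : α)
    (t : ℕ) {a a' b b' : α → ℕ} (ha : ∀ x, a x + a' x = Function.update w e t x)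
    (hb : ∀ x, b x + b' x = Function.update w e (t + 2) x) (hab : b e ≤ a e + 1) :
    2 * splittingValue S r₁ r₂ (Function.update w e (t + 1)) ≤
      (levelRankSum S r₁ a + levelRankSum S r₂ a') +
      (levelRankSum S r₁ b + levelRankSum S r₂ b') := by
  -- This shift makes both recombined splittings have total `t + 1` at `e`; away from `e` any shift
  -- preserves the total `w x`.
  obtain ⟨k, hk⟩ : ∃ k, b e + k = a e + 1 := ⟨a e + 1 - b e, by omega⟩
  have s₁ := levelRankSum_translation_submodular S h₁ a b k
  have s₂ := levelRankSum_translation_submodular S h₂ b' a' k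
  have hae := ha e
  have hbe := hb e
  simp only [Function.update_self] at hae hbe
  have c := splittingValue_le S r₁ r₂ (w := Function.update w e (t + 1))
    (u := fun x => max (a x - k) (b x)) (v := fun x => min (b' x) (a' x + k)) fun x => by
      by_cases hx : x = e
      · subst hx
        simp only [Function.update_self]
        omega
      · have := ha x
        have := hb x
        simp only [Function.update_of_ne hx] at *
        omega
  have d := splittingValue_le S r₁ r₂ (w := Function.update w e (t + 1))
    (u := fun x => min (a x) (b x + k)) (v := fun x => max (b' x - k) (a' x)) fun x => by
      by_cases hx : x = e
      · subst hx
        simp only [Function.update_self]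
        omega
      · have := ha x
        have := hb x
        simp only [Function.update_of_ne hx] at *
        omega
  omega

/-- The splitting value is convex in the weight of each single element. -/
theorem splittingValue_convex {α : Type*} [DecidableEq α] (S : Finset α)
    {r₁ r₂ : Finset α → ℕ} (h₁ : IsMatroidRank r₁) (h₂ : IsMatroidRank r₂) (w : α → ℕ) (e : α)
    (t : ℕ) :
    2 * splittingValue S r₁ r₂ (Function.update w e (t + 1)) ≤
      splittingValue S r₁ r₂ (Function.update w e t) +
      splittingValue S r₁ r₂ (Function.update w e (t + 2)) := by
  obtain ⟨a, a', ha, hA⟩ := exists_splitting S r₁ r₂ (Function.update w e t)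
  obtain ⟨b, b', hb, hB⟩ := exists_splitting S r₁ r₂ (Function.update w e (t + 2))
  rw [← hA, ← hB]
  by_cases hab : b e ≤ a e + 1
  · exact two_mul_splittingValue_le_of_splittings S h₁ h₂ w e t ha hb hab
  -- Here `b' e ≤ a' e`, so the same exchange works with the two matroids swapped.
  · have hae := ha e
    have hbe := hb e
    simp only [Function.update_self] at hae hbe
    have := two_mul_splittingValue_le_of_splittings S h₂ h₁ w e t
      (a := a') (a' := a) (b := b') (b' := b) (fun x => by rw [add_comm, ha]) (fun x => by rw [add_comm, hb])
      (by omega : b' e ≤ a' e + 1)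
    rw [splittingValue_comm] at this
    omega

/-- An integer-valued convex sequence that has increased before `t` has slope at least one
after `t`. -/
theorem le_of_convex_of_lt {f : ℕ → ℕ} (hf : ∀ t, 2 * f (t + 1) ≤ f t + f (t + 2)) {t T : ℕ}
    (h : f 0 < f t) (hT : t ≤ T) : f t + (T - t) ≤ f T := by
  have key : ∀ n, f 0 < f n → f n < f (n + 1) := by
    intro n
    induction n with
    | zero => intro h; omega
    | succ n ih =>
      intro h
      have : 2 * f (n + 1) ≤ f n + f (n + 1 + 1) := hf n
      by_cases hn : f 0 < f n
      · have := ih hn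
        omega
      · omega
  induction T, hT using Nat.le_induction with
  | base => simp
  | succ T hT ih => have := key T (by omega); omega

/-! ### Level rank sums after adding one element -/

theorem levelRankSum_insert_update_zero {α : Type*} [DecidableEq α] {S : Finset α} {e : α}
    (he : e ∉ S) {r : Finset α → ℕ} (hr : IsMatroidRank r) (u : α → ℕ) :
    levelRankSum (insert e S) r (Function.update u e 0) = levelRankSum S r u := by
  have hu : ∀ x ∈ S, Function.update u e 0 x = u x := fun x hx =>
    Function.update_of_ne (ne_of_mem_of_not_mem hx he) _ _
  rw [levelRankSum_eq (N := S.sup u) (insert e S) hr.empty, levelRankSum]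
  · refine Finset.sum_congr rfl fun j _ => ?_
    rw [Finset.filter_insert, if_neg (by simp), Finset.filter_congr fun x hx => by rw [hu x hx]]
  · intro x hx
    rcases Finset.mem_insert.1 hx with rfl | hx
    · simp
    · rw [hu x hx]; exact Finset.le_sup hx

theorem levelRankSum_insert_of_loop {α : Type*} [DecidableEq α] {S : Finset α} {e : α}
    (he : e ∉ S) {r : Finset α → ℕ} (hr : IsMatroidRank r) (hl : r {e} = 0) (u : α → ℕ) (n : ℕ) :
    levelRankSum (insert e S) r (Function.update u e n) = levelRankSum S r u := by
  have hu : ∀ x ∈ S, Function.update u e n x = u x := fun x hx =>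
    Function.update_of_ne (ne_of_mem_of_not_mem hx he) _ _
  have hN : ∀ x ∈ S, u x ≤ n + S.sup u := fun x hx => (Finset.le_sup hx).trans (by omega)
  rw [levelRankSum_eq (N := n + S.sup u) (insert e S) hr.empty,
    levelRankSum_eq (N := n + S.sup u) S hr.empty u hN]
  · refine Finset.sum_congr rfl fun j _ => ?_
    rw [Finset.filter_insert, Finset.filter_congr fun x hx => by rw [hu x hx]]
    split_ifs
    · rw [hr.insert_loop hl]
    · rfl
  · intro x hx
    rcases Finset.mem_insert.1 hx with rfl | hx
    · simp
    · rw [hu x hx]; exact hN x hx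

/-- Since `n` dominates the other weights, `e` lies in each of the first `n` level sets, and each
contributes 1 plus its contracted rank. -/
theorem levelRankSum_insert_of_contract {α : Type*} [DecidableEq α] {S : Finset α} {e : α}
    (he : e ∉ S) {r : Finset α → ℕ} (hr : IsMatroidRank r) (h1 : r {e} = 1) (u : α → ℕ) {n : ℕ}
    (hn : ∀ x ∈ S, u x ≤ n) :
    levelRankSum (insert e S) r (Function.update u e n) =
      n + levelRankSum S (fun X => r (insert e X) - 1) u := by
  have hu : ∀ x ∈ S, Function.update u e n x = u x := fun x hx =>
    Function.update_of_ne (ne_of_mem_of_not_mem hx he) _ _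
  rw [levelRankSum_eq (N := n) (insert e S) hr.empty,
    levelRankSum_eq (N := n) S (hr.contract h1).empty u hn]
  · have hsum : n + ∑ j ∈ Finset.range n, (r (insert e {x ∈ S | j < u x}) - 1) =
        ∑ j ∈ Finset.range n, (1 + (r (insert e {x ∈ S | j < u x}) - 1)) := by
      simp [Finset.sum_add_distrib]
    rw [hsum]
    refine Finset.sum_congr rfl fun j hj => ?_
    rw [Finset.filter_insert, Finset.filter_congr fun x hx => by rw [hu x hx],
      if_pos (by simpa using hj)]
    have := hr.mono {e} (insert e {x ∈ S | j < u x}) (by simp)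
    omega
  · intro x hx
    rcases Finset.mem_insert.1 hx with rfl | hx
    · simp
    · rw [hu x hx]; exact hn x hx

/-! ### The weight splitting theorem -/

/-- Weight splitting for weighted matroid intersection. -/
theorem exists_common_indep_splittingValue_le {α : Type*} [DecidableEq α] (w : α → ℕ)
    (S : Finset α) : ∀ r₁ r₂ : Finset α → ℕ, IsMatroidRank r₁ → IsMatroidRank r₂ →
    ∃ I ⊆ S, r₁ I = I.card ∧ r₂ I = I.card ∧ splittingValue S r₁ r₂ w ≤ ∑ e ∈ I, w e := by
  induction S using Finset.induction_on with
  | empty =>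
    intro r₁ r₂ h₁ h₂
    refine ⟨∅, le_rfl, by simp [h₁.empty], by simp [h₂.empty], ?_⟩
    exact (splittingValue_le ∅ r₁ r₂ (u := w) (v := 0) (by simp)).trans (by simp [levelRankSum])
  | insert e S he ih =>
    intro r₁ r₂ h₁ h₂
    obtain ⟨I, hIS, hI₁, hI₂, hI⟩ := ih r₁ r₂ h₁ h₂
    obtain ⟨u, v, huv, huv'⟩ := exists_splitting S r₁ r₂ w
    have hsum : ∀ {u v : α → ℕ} (m n : ℕ), (∀ x, u x + v x = w x) → ∀ x,
        Function.update u e m x + Function.update v e n x = Function.update w e (m + n) x := by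
      intro u v m n h x
      by_cases hx : x = e
      · subst hx; simp
      · simp [hx, h]
    have hdel : splittingValue (insert e S) r₁ r₂ (Function.update w e 0) ≤ ∑ e ∈ I, w e := by
      refine le_trans (splittingValue_le _ _ _ (hsum 0 0 huv)) ?_
      rwa [levelRankSum_insert_update_zero he h₁, levelRankSum_insert_update_zero he h₂, huv']
    have hIS' : I ⊆ insert e S := hIS.trans (Finset.subset_insert e S)
    by_cases hle : splittingValue (insert e S) r₁ r₂ w ≤
        splittingValue (insert e S) r₁ r₂ (Function.update w e 0)
    · exact ⟨I, hIS', hI₁, hI₂, hle.trans hdel⟩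
    have l₁ := h₁.singleton_le e
    have l₂ := h₂.singleton_le e
    by_cases e₁ : r₁ {e} = 0
    · refine ⟨I, hIS', hI₁, hI₂, ?_⟩
      -- A loop adds no rank, so the whole weight of `e` is free on its side.
      have := splittingValue_le (insert e S) r₁ r₂ (hsum (w e) 0 huv)
      rw [levelRankSum_insert_of_loop he h₁ e₁, levelRankSum_insert_update_zero he h₂, huv',
        add_zero, Function.update_eq_self] at this
      exact this.trans hI
    by_cases e₂ : r₂ {e} = 0
    · refine ⟨I, hIS', hI₁, hI₂, ?_⟩
      have := splittingValue_le (insert e S) r₁ r₂ (hsum 0 (w e) huv)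
      rw [levelRankSum_insert_of_loop he h₂ e₂, levelRankSum_insert_update_zero he h₁, huv',
        zero_add, Function.update_eq_self] at this
      exact this.trans hI
    replace e₁ : r₁ {e} = 1 := by omega
    replace e₂ : r₂ {e} = 1 := by omega
    obtain ⟨J, hJS, hJ₁, hJ₂, hJ⟩ := ih _ _ (h₁.contract e₁) (h₂.contract e₂)
    obtain ⟨u, v, huv, huv'⟩ := exists_splitting S (fun X => r₁ (insert e X) - 1)
      (fun X => r₂ (insert e X) - 1) w
    have heJ : e ∉ J := fun h => he (hJS h)
    have m₁ := h₁.mono {e} (insert e J) (by simp)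
    have m₂ := h₂.mono {e} (insert e J) (by simp)
    have hcard := Finset.card_insert_of_notMem heJ
    refine ⟨insert e J, Finset.insert_subset_insert e hJS, by omega, by omega, ?_⟩
    rw [Finset.sum_insert heJ]
    -- The weight of `e` is raised until its share dominates in both `u` and `v`; convexity then
    -- pays back the excess `S.sup u + S.sup v`.
    have hcon := splittingValue_le (insert e S) r₁ r₂ (hsum (w e + S.sup u) (S.sup v) huv)
    rw [levelRankSum_insert_of_contract he h₁ e₁ u
        fun x hx => (Finset.le_sup hx).trans (Nat.le_add_left _ _),
      levelRankSum_insert_of_contract he h₂ e₂ v fun x hx => Finset.le_sup hx] at hcon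
    have hcvx := le_of_convex_of_lt
      (f := fun t => splittingValue (insert e S) r₁ r₂ (Function.update w e t)) (T := w e + S.sup u + S.sup v) (t := w e)
      (splittingValue_convex (insert e S) h₁ h₂ w e)
      (by simp only [Function.update_eq_self]; omega) (by omega)
    simp only [Function.update_eq_self] at hcvx
    omega

/-! ### Matroid ranks and layers of copies -/

/-- The rank function of a matroid, restricted to finite sets. -/
noncomputable def finsetRank {α : Type*} (M : Matroid α) (X : Finset α) : ℕ :=
  (M.eRk (X : Set α)).toNat

theorem coe_finsetRank {α : Type*} (M : Matroid α) (X : Finset α) :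
    (finsetRank M X : ℕ∞) = M.eRk (X : Set α) :=
  ENat.natCast_toNat (ne_top_of_le_ne_top (by simp) (M.eRk_le_encard (X : Set α)))

theorem isMatroidRank_finsetRank {α : Type*} [DecidableEq α] (M : Matroid α) :
    IsMatroidRank (finsetRank M) where
  empty := by simp [finsetRank]
  singleton_le e := by
    have := M.eRk_le_encard (({e} : Finset α) : Set α)
    rw [← coe_finsetRank, Finset.coe_singleton, Set.encard_singleton] at this
    exact_mod_cast this
  mono X Y h := by
    have := M.eRk_mono (Finset.coe_subset.2 h)
    rw [← coe_finsetRank, ← coe_finsetRank] at this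
    exact_mod_cast this
  submod X Y := by
    have := M.eRk_inter_add_eRk_union_le (X : Set α) (Y : Set α)
    rw [← Finset.coe_union, ← Finset.coe_inter] at this
    simp only [← coe_finsetRank] at this
    norm_cast at this
    omega

theorem finsetRank_eq_card_iff {α : Type*} (M : Matroid α) (X : Finset α) :
    finsetRank M X = X.card ↔ M.Indep (X : Set α) := by
  rw [Matroid.indep_iff_eRk_eq_encard_of_finite X.finite_toSet, ← coe_finsetRank,
    Set.encard_coe_eq_coe_finsetCard]
  norm_cast

/-- A set of copies all of whose layers are independent and below the weight function `u` has at
most as many elements as the level rank sum of `u`. -/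
theorem card_le_levelRankSum {α : Type*} [DecidableEq α] (M : Matroid α) (S : Finset α)
    (u : α → ℕ) (K : Finset (α × ℕ)) (σ : α × ℕ → ℕ) (hS : ∀ p ∈ K, p.1 ∈ S)
    (hσ : ∀ p ∈ K, σ p < u p.1) (hinj : ∀ p ∈ K, ∀ q ∈ K, p.1 = q.1 → σ p = σ q → p = q)
    (hind : ∀ i, M.Indep {e | ∃ j, (e, j) ∈ K ∧ σ (e, j) = i}) :
    K.card ≤ levelRankSum S (finsetRank M) u := by
  rw [levelRankSum, Finset.card_eq_sum_card_fiberwise (f := σ) (t := Finset.range (S.sup u))]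
  · refine Finset.sum_le_sum fun i _ => ?_
    have hcard : ({p ∈ K | σ p = i}.image Prod.fst).card = {p ∈ K | σ p = i}.card := by
      refine Finset.card_image_of_injOn fun p hp q hq h => ?_
      simp only [Finset.coe_filter, Set.mem_ofPred_eq] at hp hq
      exact hinj p hp.1 q hq.1 h (hp.2.trans hq.2.symm)
    have hI : M.Indep ({p ∈ K | σ p = i}.image Prod.fst : Finset α) := by
      convert hind i
      ext e
      simp
    rw [← hcard, ← (finsetRank_eq_card_iff M _).2 hI]
    refine (isMatroidRank_finsetRank M).mono _ _ fun e => ?_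
    simp only [Finset.mem_image, Finset.mem_filter]
    rintro ⟨p, ⟨hp, rfl⟩, rfl⟩
    exact ⟨hS p hp, hσ p hp⟩
  · intro p hp
    simp only [Finset.coe_range, Set.mem_Iio]
    exact (hσ p hp).trans_le (Finset.le_sup (hS p hp))

/-- The matroid on a set `G` of copies whose independent sets are those with all layers, given
by `σ`, independent in `M`. -/
def layerMatroid {α : Type*} (M : Matroid α) (σ : α × ℕ → ℕ) (G : Set (α × ℕ)) :
    Matroid (α × ℕ) :=
  ((Matroid.sum' fun _ : ℕ => M).comap fun p => (σ p, p.1)).restrict G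

theorem layerMatroid_indep_iff {α : Type*} (M : Matroid α) {σ : α × ℕ → ℕ} {G : Set (α × ℕ)}
    (hσ : ∀ p ∈ G, ∀ q ∈ G, p.1 = q.1 → σ p = σ q → p = q) (I : Set (α × ℕ)) :
    (layerMatroid M σ G).Indep I ↔
      I ⊆ G ∧ ∀ i, M.Indep {e | ∃ j, (e, j) ∈ I ∧ σ (e, j) = i} := by
  have hlayer : ∀ i, Prod.mk i ⁻¹' ((fun p => (σ p, p.1)) '' I) =
      {e | ∃ j, (e, j) ∈ I ∧ σ (e, j) = i} := by
    intro i
    ext e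
    simp only [Set.mem_preimage, Set.mem_image, Prod.mk.injEq, Prod.exists, Set.mem_ofPred_eq]
    exact ⟨fun ⟨_, j, h, h1, h2⟩ => ⟨j, h2 ▸ h, h2 ▸ h1⟩, fun ⟨j, h, h1⟩ => ⟨e, j, h, h1, rfl⟩⟩
  rw [layerMatroid, Matroid.restrict_indep_iff, Matroid.comap_indep_iff, Matroid.sum'_indep_iff,
    and_comm]
  simp only [hlayer]
  refine and_congr_right fun hI => and_iff_left fun p hp q hq h => ?_
  simp only [Prod.mk.injEq] at h
  exact hσ p (hI hp) q (hI hq) h.2 h.1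

theorem layerMatroid_indep_iff_first {α : Type*} (M : Matroid α) {W : ℕ} {w : α → ℕ}
    (hw : ∀ e ∈ M.E, w e ≤ W) (I : Set (α × ℕ)) :
    (layerMatroid M (fun p => p.2 - 1) (unfoldedGround M.E w)).Indep I ↔
      UnfoldedIndepFirst M w W I := by
  rw [layerMatroid_indep_iff]
  · refine and_congr_right fun hI => ?_
    have hl : ∀ i, {e | ∃ j, (e, j) ∈ I ∧ j - 1 = i} = firstLayer I (i + 1) := by
      intro i
      ext e
      refine ⟨fun ⟨j, hj, h⟩ => ?_, fun h => ⟨i + 1, h, rfl⟩⟩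
      have := (hI hj).2.1
      obtain rfl : j = i + 1 := by simp only at this; omega
      exact hj
    simp only [hl]
    refine ⟨fun h i hi _ => Nat.sub_add_cancel hi ▸ h (i - 1), fun h i => ?_⟩
    -- Layers here are numbered from 0; those beyond `W` are empty.
    by_cases hi : i + 1 ≤ W
    · exact h _ (by omega) hi
    · convert M.empty_indep
      refine Set.eq_empty_of_forall_notMem fun e he => hi ?_
      exact (hI he).2.2.trans (hw e (hI he).1)
  · rintro ⟨e, i⟩ ⟨-, hi, -⟩ ⟨f, j⟩ ⟨-, hj, -⟩ rfl h
    simp only at hi hj h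
    simp only [Prod.mk.injEq, true_and]
    omega

theorem layerMatroid_indep_iff_second {α : Type*} (M : Matroid α) {W : ℕ} {w : α → ℕ}
    (hw : ∀ e ∈ M.E, w e ≤ W) (I : Set (α × ℕ)) :
    (layerMatroid M (fun p => w p.1 - p.2) (unfoldedGround M.E w)).Indep I ↔
      UnfoldedIndepSecond M w W I := by
  rw [layerMatroid_indep_iff]
  · refine and_congr_right fun hI => ?_
    have hl : ∀ i, {e | ∃ j, (e, j) ∈ I ∧ w e - j = i} = secondLayer w I (i + 1) := by
      intro i
      ext e
      refine ⟨fun ⟨j, hj, h⟩ => ⟨j, ?_, hj⟩, fun ⟨j, h, hj⟩ => ⟨j, hj, by omega⟩⟩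
      have := (hI hj).2.2
      simp only at this
      omega
    simp only [hl]
    refine ⟨fun h i hi _ => Nat.sub_add_cancel hi ▸ h (i - 1), fun h i => ?_⟩
    by_cases hi : i + 1 ≤ W
    · exact h _ (by omega) hi
    · convert M.empty_indep
      refine Set.eq_empty_of_forall_notMem fun e ⟨j, h, he⟩ => hi ?_
      have h1 := (hI he).2.1
      have h2 := hw e (hI he).1
      simp only at h1
      omega
  · rintro ⟨e, i⟩ ⟨-, -, hi⟩ ⟨f, j⟩ ⟨-, -, hj⟩ rfl h
    simp only at hi hj h
    simp only [Prod.mk.injEq, true_and]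
    omega

/-! ### Weak duality and conclusion -/

/-- Weak duality: a common independent set of the unfolded matroids is at most as large as the
value of any splitting of the weights. -/
theorem card_le_of_layerMatroid_indep {α : Type*} [DecidableEq α] (M₁ M₂ : Matroid α)
    {E : Set α} {S : Finset α} (hS : E ⊆ S) {w u v : α → ℕ} (huv : ∀ x, u x + v x = w x)
    {K : Finset (α × ℕ)}
    (h₁ : (layerMatroid M₁ (fun p => p.2 - 1) (unfoldedGround E w)).Indep K)
    (h₂ : (layerMatroid M₂ (fun p => w p.1 - p.2) (unfoldedGround E w)).Indep K) :
    K.card ≤ levelRankSum S (finsetRank M₁) u + levelRankSum S (finsetRank M₂) v := by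
  have hinj₁ : ∀ p ∈ unfoldedGround E w, ∀ q ∈ unfoldedGround E w, p.1 = q.1 →
      p.2 - 1 = q.2 - 1 → p = q := by
    rintro ⟨e, i⟩ ⟨-, hi, -⟩ ⟨f, j⟩ ⟨-, hj, -⟩ rfl h
    simp only at hi hj h
    simp only [Prod.mk.injEq, true_and]
    omega
  have hinj₂ : ∀ p ∈ unfoldedGround E w, ∀ q ∈ unfoldedGround E w, p.1 = q.1 →
      w p.1 - p.2 = w q.1 - q.2 → p = q := by
    rintro ⟨e, i⟩ ⟨-, -, hi⟩ ⟨f, j⟩ ⟨-, -, hj⟩ rfl h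
    simp only at hi hj h
    simp only [Prod.mk.injEq, true_and]
    omega
  obtain ⟨hK, h₁⟩ := (layerMatroid_indep_iff M₁ hinj₁ _).1 h₁
  obtain ⟨-, h₂⟩ := (layerMatroid_indep_iff M₂ hinj₂ _).1 h₂
  -- Copies of index at most `u` are charged to `M₁`; the others satisfy `w p.1 - p.2 < v p.1` and
  -- are charged to `M₂`.
  rw [← Finset.card_filter_add_card_filter_not (fun p : α × ℕ => p.2 ≤ u p.1)]
  refine add_le_add ?_ ?_
  · refine card_le_levelRankSum M₁ S u _ (fun p => p.2 - 1) ?_ ?_ ?_ ?_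
    · exact fun p hp => hS (hK (Finset.mem_filter.1 hp).1).1
    · intro p hp
      obtain ⟨hp, h⟩ := Finset.mem_filter.1 hp
      have := (hK hp).2.1
      omega
    · exact fun p hp q hq =>
        hinj₁ p (hK (Finset.mem_filter.1 hp).1) q (hK (Finset.mem_filter.1 hq).1)
    · exact fun i => (h₁ i).subset fun e ⟨j, hj, h⟩ => ⟨j, (Finset.mem_filter.1 hj).1, h⟩
  · refine card_le_levelRankSum M₂ S v _ (fun p => w p.1 - p.2) ?_ ?_ ?_ ?_
    · exact fun p hp => hS (hK (Finset.mem_filter.1 hp).1).1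
    · intro p hp
      obtain ⟨hp, h⟩ := Finset.mem_filter.1 hp
      have := (hK hp).2.2
      have := huv p.1
      omega
    · exact fun p hp q hq =>
        hinj₂ p (hK (Finset.mem_filter.1 hp).1) q (hK (Finset.mem_filter.1 hq).1)
    · exact fun i => (h₂ i).subset fun e ⟨j, hj, h⟩ => ⟨j, (Finset.mem_filter.1 hj).1, h⟩

theorem exists_unfoldedIndep_card_eq {α : Type*} (M₁ M₂ : Matroid α) (W : ℕ)
    (w : α → ℕ) {J : Finset α} (h₁ : M₁.Indep J) (h₂ : M₂.Indep J) :
    ∃ K : Finset (α × ℕ), UnfoldedIndepFirst M₁ w W K ∧ UnfoldedIndepSecond M₂ w W K ∧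
      K.card = ∑ e ∈ J, w e := by
  refine ⟨(J.sigma fun e => Finset.Icc 1 (w e)).map (Equiv.sigmaEquivProd α ℕ).toEmbedding,
    ⟨?_, fun i _ _ => h₁.subset ?_⟩, ⟨?_, fun i _ _ => h₂.subset ?_⟩, by simp⟩
  · rintro ⟨e, i⟩ h
    simp at h
    exact ⟨h₁.subset_ground h.1, h.2⟩
  · intro e h
    simp [firstLayer] at h
    exact h.1
  · rintro ⟨e, i⟩ h
    simp at h
    exact ⟨h₂.subset_ground h.1, h.2⟩
  · rintro e ⟨j, -, h⟩
    simp at h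
    exact h.1

theorem mainTheorem2 {α : Type*} (M₁' M₂' : Matroid α) (hfin : M₁'.E.Finite)
    (hE : M₂'.E = M₁'.E) (W : ℕ) (w : α → ℕ)
    (hw : ∀ e ∈ M₁'.E, 1 ≤ w e ∧ w e ≤ W) :
    ∃ M₁ M₂ : Matroid (α × ℕ),
      (M₁.E = unfoldedGround M₁'.E w ∧ ∀ I, M₁.Indep I ↔ UnfoldedIndepFirst M₁' w W I) ∧
      (M₂.E = unfoldedGround M₁'.E w ∧ ∀ I, M₂.Indep I ↔ UnfoldedIndepSecond M₂' w W I) ∧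
      ∃ opt : ℕ, IsMaxCommonIndepWeight M₁' M₂' w opt ∧ IsMaxCommonIndepCard M₁ M₂ opt := by
  classical
  have i₁ := layerMatroid_indep_iff_first M₁' fun e he => (hw e he).2
  have i₂ := layerMatroid_indep_iff_second M₂' (W := W) (w := w) fun e he => (hw e (hE ▸ he)).2
  rw [hE] at i₂
  obtain ⟨I, -, hI₁, hI₂, hI⟩ := exists_common_indep_splittingValue_le w hfin.toFinset
    (finsetRank M₁') (finsetRank M₂') (isMatroidRank_finsetRank M₁') (isMatroidRank_finsetRank M₂')
  rw [finsetRank_eq_card_iff] at hI₁ hI₂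
  obtain ⟨u, v, huv, huv'⟩ := exists_splitting hfin.toFinset (finsetRank M₁') (finsetRank M₂') w
  have hub : ∀ K : Finset (α × ℕ), UnfoldedIndepFirst M₁' w W K → UnfoldedIndepSecond M₂' w W K →
      K.card ≤ ∑ e ∈ I, w e := fun K h₁ h₂ =>
    (card_le_of_layerMatroid_indep M₁' M₂' (by simp) huv ((i₁ K).2 h₁) ((i₂ K).2 h₂)).trans
      (huv'.trans_le hI)
  refine ⟨_, _, ⟨rfl, i₁⟩, ⟨rfl, i₂⟩, ∑ e ∈ I, w e, ⟨⟨I, hI₁, hI₂, rfl⟩, ?_⟩, ?_, ?_⟩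
  · rintro _ ⟨J, h₁, h₂, rfl⟩
    obtain ⟨K, k₁, k₂, hK⟩ := exists_unfoldedIndep_card_eq M₁' M₂' W w h₁ h₂
    exact hK ▸ hub K k₁ k₂
  · obtain ⟨K, k₁, k₂, hK⟩ := exists_unfoldedIndep_card_eq M₁' M₂' W w hI₁ hI₂
    exact ⟨K, (i₁ K).2 k₁, (i₂ K).2 k₂, hK⟩
  · rintro _ ⟨K, k₁, k₂, rfl⟩
    exact hub K ((i₁ K).1 k₁) ((i₂ K).1 k₂)
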